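/- Let $\mathbb X,\mathbb Y$ be Polish spaces with their Borel $\sigma$-fields, and consider the partially observed Markov source $x_{t+1}=f(x_t,w_t)$, $y_t=g(x_t,r_t)$, $t\ge 0$, on a probability space, where $f,g$ are measurable, $\{w_t\}$ and $\{r_t\}$ are i.i.d. sequences in arbitrary measurable spaces, and $x_0$, $\{w_t\}$, $\{r_t\}$ are mutually independent. Let $\mathcal M_t$, $t\ge0$, be fixed finite sets, let $\mathbb U$ be a nonempty measurable space, let $c:\mathbb X\times\mathbb U\to\mathbb R$ be bounded and measurable, and let $T\in\mathbb N$. A (causal) composite quantization policy is a sequence $\Pi=\{Q_t\}$ of Borel maps $Q_t:\prod_{s=0}^{t-1}\mathcal M_s\times\mathbb Y^{t+1}\to\mathcal M_t$, generating $q_t=Q_t(q_{[0,t-1]},y_{[0,t]})$; a receiver policy is a sequence $\gamma=\{\gamma_t\}$ of measurable maps $\gamma_t:\prod_{s=0}^{t}\mathcal M_s\to\mathbb U$, with $v_t=\gamma_t(q_{[0,t]})$. Put $J(\Pi,\gamma)=E\big[\sum_{t=0}^{T-1}c(x_t,v_t)\big]$ and $J(\Pi)=\inf_\gamma J(\Pi,\gamma)$.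 Let $\mathcal P(\mathbb X)$ be the space of Borel probability measures on $\mathbb X$ with the topology of weak convergence, and let $\pi_t\in\mathcal P(\mathbb X)$, $\pi_t(A)=P(x_t\in A\mid y_{[0,t]})$, be a regular conditional probability. Say that a composite quantization policy uses only $\{\pi_t,q_{[0,t-1]}\}$ if for every $t\ge0$ it has the form $q_t=F_t(\pi_t,q_{[0,t-1]})$ with $F_t:\mathcal P(\mathbb X)\times\prod_{s=0}^{t-1}\mathcal M_s\to\mathcal M_t$ Borel. Then any composite quantization policy can be replaced, without any loss in performance, by one which uses only $\{\pi_t,q_{[0,t-1]}\}$. That is, for every composite quantization policy $\Pi$: (i) for every receiver policy $\gamma$ there is a composite quantization policy $\Pi'$ which uses only $\{\pi_t,q_{[0,t-1]}\}$ and satisfies $J(\Pi',\gamma)\le J(\Pi,\gamma)$; (ii) there is a composite quantization policy $\Pi'$ which uses only $\{\pi_t,q_{[0,t-1]}\}$ and satisfies $J(\Pi')\le J(\Pi)$. Moreover, a composite quantization policy uses only $\{\pi_t,q_{[0,t-1]}\}$ if and only if it can be expressed as a quantization policy which uses only $q_{[0,t-1]}$ to select a quantizer (a Borel map $\mathcal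 P(\mathbb X)\to\mathcal M_t$), this quantizer being applied to $\pi_t$ to generate $q_t$. -/

import Mathlib

open MeasureTheory ProbabilityTheory

noncomputable section

namespace CausalCoding

/-- A quantizer `Q(A; {1, …, m})`: a Borel measurable map from the topological space `A` to a set
with `m` elements. -/
def Quantizer (A : Type*) [TopologicalSpace A] (m : ℕ) : Type _ :=
  {Q : A → Fin m // Measurable[borel A] Q}

instance (A : Type*) [TopologicalSpace A] (m : ℕ) : CoeFun (Quantizer A m) (fun _ => A → Fin m) :=
  ⟨Subtype.val⟩

/-- A partially observed Markov source `x_{t+1} = f(x_t, w_t)`, `y_t = g(x_t, r_t)`, driven by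
i.i.d. sequences `w` and `r`, with `x_0`, `w` and `r` mutually independent. -/
structure PartiallyObservedSource {Ω : Type*} [MeasurableSpace Ω] (μ : Measure Ω)
    (X Y W R : Type*) [MeasurableSpace X] [MeasurableSpace Y] [MeasurableSpace W]
    [MeasurableSpace R] where
  f : X → W → X
  g : X → R → Y
  x₀ : Ω → X
  w : ℕ → Ω → W
  r : ℕ → Ω → R
  measurable_f : Measurable (Function.uncurry f)
  measurable_g : Measurable (Function.uncurry g)
  measurable_x₀ : Measurable x₀
  measurable_w : ∀ t, Measurable (w t)
  measurable_r : ∀ t, Measurable (r t)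
  iIndep_w : iIndepFun w μ
  iIndep_r : iIndepFun r μ
  identDistrib_w : ∀ t, IdentDistrib (w t) (w 0) μ μ
  identDistrib_r : ∀ t, IdentDistrib (r t) (r 0) μ μ
  indep_w_r : IndepFun (fun ω t => w t ω) (fun ω t => r t ω) μ
  indep_x₀ : IndepFun x₀ (fun ω => ((fun t => w t ω : ℕ → W), (fun t => r t ω : ℕ → R))) μ

namespace PartiallyObservedSource

variable {Ω X Y W R : Type*} [MeasurableSpace Ω] {μ : Measure Ω} [MeasurableSpace X]
  [MeasurableSpace Y] [MeasurableSpace W] [MeasurableSpace R]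

/-- The state process `x_t`. -/
def state (S : PartiallyObservedSource μ X Y W R) : ℕ → Ω → X
  | 0 => S.x₀
  | t + 1 => fun ω => S.f (S.state t ω) (S.w t ω)

/-- The observation process `y_t`. -/
def obs (S : PartiallyObservedSource μ X Y W R) (t : ℕ) (ω : Ω) : Y :=
  S.g (S.state t ω) (S.r t ω)

/-- The observation history `y_{[0,t]}`. -/
def obsHist (S : PartiallyObservedSource μ X Y W R) (t : ℕ) (ω : Ω) : Fin (t + 1) → Y :=
  fun s => S.obs s ω

/-- The encoder's belief `π_t(A) = P(x_t ∈ A | y_{[0,t]})` (a regular conditional probability), as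
a function of the realization of `y_{[0,t]}`. -/
def belief [StandardBorelSpace X] [Nonempty X] [IsProbabilityMeasure μ]
    (S : PartiallyObservedSource μ X Y W R) (t : ℕ) (y : Fin (t + 1) → Y) : ProbabilityMeasure X :=
  ⟨condDistrib (S.state t) (S.obsHist t) μ y, inferInstance⟩

end PartiallyObservedSource

/-- The set of histories `q_{[0,t-1]}` of quantization outputs, where the output at time `s` takes
`M s` values. It has exactly one element if `t = 0`. -/
abbrev OutHist (M : ℕ → ℕ) (t : ℕ) : Type := (s : Fin t) → Fin (M s)

/-- A (causal) composite quantization policy: at each time `t` a measurable map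
`(q_{[0,t-1]}, y_{[0,t]}) ↦ q_t`. -/
abbrev CompositePolicy (Y : Type*) [TopologicalSpace Y] (M : ℕ → ℕ) : Type _ :=
  (t : ℕ) → Quantizer (OutHist M t × (Fin (t + 1) → Y)) (M t)

/-- An admissible causal receiver policy: at each time `t` a measurable map `q_{[0,t]} ↦ v_t`. -/
abbrev ReceiverPolicy (U : Type*) [MeasurableSpace U] (M : ℕ → ℕ) : Type _ :=
  (t : ℕ) → {γ : OutHist M (t + 1) → U // Measurable γ}

/-- The outputs `q_{[0,t-1]}` generated by a composite quantization policy along the observation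
path `y`. -/
def CompositePolicy.outputs {Y : Type*} [TopologicalSpace Y] {M : ℕ → ℕ}
    (P : CompositePolicy Y M) (y : ℕ → Y) : (t : ℕ) → OutHist M t
  | 0 => fun s => s.elim0
  | t + 1 => Fin.snoc (α := fun s : Fin (t + 1) => Fin (M s)) (CompositePolicy.outputs P y t)
      (P t (CompositePolicy.outputs P y t, fun s => y s))

section

variable {Ω X Y W R U : Type*} [MeasurableSpace Ω] {μ : Measure Ω}
  [TopologicalSpace X] [MeasurableSpace X] [TopologicalSpace Y] [MeasurableSpace Y]
  [MeasurableSpace W] [MeasurableSpace R] [MeasurableSpace U] {M : ℕ → ℕ}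

/-- The expected cost `E[∑_{t=0}^{T-1} c(x_t, v_t)]`, where `v_t = γ_t(q_{[0,t]})`. -/
def expectedCost (S : PartiallyObservedSource μ X Y W R) (c : X → U → ℝ) (T : ℕ)
    (P : CompositePolicy Y M) (γ : ReceiverPolicy U M) : ℝ :=
  ∫ ω, ∑ t ∈ Finset.range T,
    c (S.state t ω) ((γ t).1 (CompositePolicy.outputs P (fun s => S.obs s ω) (t + 1))) ∂μ

/-- The policy only uses `(π_t, q_{[0,t-1]})`: each `q_t` is a Borel function of this pair, where
`𝓟(X)` carries the topology of weak convergence. -/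
def UsesOnlyBelief [OpensMeasurableSpace X] [StandardBorelSpace X] [Nonempty X]
    [IsProbabilityMeasure μ]
    (S : PartiallyObservedSource μ X Y W R) (P : CompositePolicy Y M) : Prop :=
  ∀ t, ∃ F : Quantizer (ProbabilityMeasure X × OutHist M t) (M t),
    ∀ q y, P t (q, y) = F (S.belief t y, q)

/-- The policy is a quantization policy which uses `q_{[0,t-1]}` to select a quantizer on `𝓟(X)`
(with the topology of weak convergence); this quantizer maps `π_t` to `q_t`. -/
def SelectsBeliefQuantizer [OpensMeasurableSpace X] [StandardBorelSpace X] [Nonempty X]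
    [IsProbabilityMeasure μ]
    (S : PartiallyObservedSource μ X Y W R) (P : CompositePolicy Y M) : Prop :=
  ∀ t, ∃ τ : OutHist M t → Quantizer (ProbabilityMeasure X) (M t),
    ∀ q y, P t (q, y) = τ q (S.belief t y)

end

end CausalCoding

end

/-! The quantizer does not influence the source, so the belief `π_t` is a Markov chain relative to
the observation history: given `y_{[0,t]}`, the law of `π_{t+1}` depends on `π_t` alone
(`lintegral_belief_succ`). Past outputs are functions of the observations. Hence, if `κ_t` is the
conditional law of `q_t` given `(π_t, q_{[0,t-1]})` under `Π`, the randomized policy that draws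
`q_t` from `κ_t` reproduces the joint law of `((π_t, q_{[0,t-1]}), q_t)` at every `t`
(`map_info_out_eq_outLaw`). The stage cost depends on that law only (`lintegral_stageCost`), so
randomizing this way costs nothing.

The randomization is then removed one time at a time (`exists_deterministic_update`). With the other
kernels fixed, each expected cost is affine in the kernel at time `t`, and that kernel is a mixture,
over a uniform seed, of deterministic maps. Some seed does at least as well as the average. The
argument survives an infimum over countably many receiver policies, since an infimum of averages is
at least the average of the infima. A constant sequence of receivers gives (i), a minimizing
sequence gives (ii). No dynamic programming is needed.

The equivalence of the two forms of policy reduces to joint versus sectionwise measurability, which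
agree because output histories range over a finite set. -/

noncomputable section

namespace CausalCoding

/-! ### The Borel σ-algebra of the weak topology is the one generated by evaluations. -/

section BorelProbabilityMeasure

open TopologicalSpace Filter Topology ENNReal NNReal

variable {X : Type*} [TopologicalSpace X] [MeasurableSpace X] [BorelSpace X]

/-- Portmanteau: `ν ↦ ν G` is lower semicontinuous for open `G`. -/
lemma isOpen_setOf_lt_measure [HasOuterApproxClosed X] {G : Set X} (hG : IsOpen G) (r : ℝ≥0∞) :
    IsOpen {ν : ProbabilityMeasure X | r < (ν : Measure X) G} := by
  rw [isOpen_iff_mem_nhds]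
  intro ν hν
  have h := ProbabilityMeasure.le_liminf_measure_open_of_tendsto (μ := ν) (L := 𝓝 ν) (μs := id)
    tendsto_id hG
  exact eventually_lt_of_lt_liminf (lt_of_lt_of_le hν h)

/-- Quantizers are Borel for weak convergence, while kernels see the evaluation σ-algebra; this
identifies the two. One inclusion holds because open sets are a generating π-system. For the other,
the weak topology has a countable subbasis of sets `{ν | q < ν G}`, with `q` rational and `G` a
finite union of basic open sets, and these are evaluation-measurable. -/
instance borelSpace_probabilityMeasure [PseudoMetrizableSpace X] [SecondCountableTopology X] :
    BorelSpace (ProbabilityMeasure X) where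
  measurable_eq := by
    let : PseudoMetricSpace X := pseudoMetrizableSpacePseudoMetric X
    refine le_antisymm ?_ ?_
    · have h : Measurable[borel (ProbabilityMeasure X)]
          (fun ν : ProbabilityMeasure X => (ν : Measure X)) := by
        let : MeasurableSpace (ProbabilityMeasure X) := borel _
        have : BorelSpace (ProbabilityMeasure X) := ⟨rfl⟩
        refine Measurable.measure_of_isPiSystem_of_isProbabilityMeasure
          (BorelSpace.measurable_eq (α := X)) isPiSystem_isOpen fun G hG => ?_
        exact measurable_of_Ioi fun r => (isOpen_setOf_lt_measure hG r).measurableSet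
      exact MeasurableSpace.comap_le_iff_le_map.2 h
    · set S : Set (Set (ProbabilityMeasure X)) :=
        (fun p : Finset (Set X) × ℚ => {ν : ProbabilityMeasure X |
          ((Real.toNNReal p.2 : ℝ≥0) : ℝ≥0∞) < (ν : Measure X) (⋃ s ∈ p.1, s)}) ''
          ({T : Finset (Set X) | (T : Set (Set X)) ⊆ countableBasis X} ×ˢ Set.univ) with hS
      have hfin : {T : Finset (Set X) | (T : Set (Set X)) ⊆ countableBasis X}.Countable := by
        have h := Set.countable_ofPred_finite_subset (countable_countableBasis X)
        exact (h.preimage (f := fun T : Finset (Set X) => (T : Set (Set X)))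
          Finset.coe_injective).mono fun T hT => And.intro T.finite_toSet hT
      have hcount : S.Countable := (hfin.prod Set.countable_univ).image _
      have hopen : ∀ T : Finset (Set X), (T : Set (Set X)) ⊆ countableBasis X →
          IsOpen (⋃ s ∈ T, s) := fun T hT =>
        isOpen_biUnion fun s hs => isOpen_of_mem_countableBasis (hT hs)
      have htop : (inferInstance : TopologicalSpace (ProbabilityMeasure X)) = generateFrom S := by
        refine le_antisymm (le_generateFrom ?_) ?_
        · rintro _ ⟨⟨T, q⟩, ⟨hT, -⟩, rfl⟩
          exact isOpen_setOf_lt_measure (hopen T hT) _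
        -- The converse portmanteau criterion is applied along a neighbourhood filter of the
        -- generated topology; countability of `S` makes that filter countably generated.
        · have hsc : @SecondCountableTopology _ (generateFrom S) :=
            @SecondCountableTopology.mk _ (generateFrom S) ⟨S, hcount, rfl⟩
          have hfc : @FirstCountableTopology _ (generateFrom S) :=
            @SecondCountableTopology.to_firstCountableTopology _ (generateFrom S) hsc
          refine le_of_nhds_le_nhds fun ν => ?_
          have : (@nhds _ (generateFrom S) ν).IsCountablyGenerated :=
            @FirstCountableTopology.nhds_generated_countable _ (generateFrom S) hfc ν
          refine tendsto_of_forall_isOpen_le_liminf' (μs := id)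
            (L := @nhds _ (generateFrom S) ν) fun G hG => ?_
          refine le_of_forall_lt_imp_le_of_dense fun r hr => ?_
          obtain ⟨q, hq0, hrq, hqG⟩ := ENNReal.lt_iff_exists_rat_btwn.1 hr
          have hqG' : Real.toNNReal q < ν G := by
            rw [← ENNReal.coe_lt_coe]
            simpa using hqG
          -- `G` is a countable union of basic sets, so a finite subunion already has mass above
          -- `q`.
          obtain ⟨T, hT, hqT, hTG⟩ := ν.exists_lt_measure_biUnion_of_isOpen
            (S := countableBasis X) (fun u hu x hx => by
              obtain ⟨s, hs, hxs, hsu⟩ :=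
                (isBasis_countableBasis X).exists_subset_of_mem_open hx hu
              exact ⟨s, hs, (isOpen_of_mem_countableBasis hs).mem_nhds hxs, hsu⟩) hG hqG'
          have hmem : {ν : ProbabilityMeasure X | ((Real.toNNReal q : ℝ≥0) : ℝ≥0∞)
              < (ν : Measure X) (⋃ s ∈ T, s)} ∈ @nhds _ (generateFrom S) ν := by
            have hTS : {ν : ProbabilityMeasure X | ((Real.toNNReal q : ℝ≥0) : ℝ≥0∞)
                < (ν : Measure X) (⋃ s ∈ T, s)} ∈ S :=
              ⟨(T, q), ⟨fun s hs => hT s hs, trivial⟩, rfl⟩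
            refine @IsOpen.mem_nhds _ (generateFrom S) ν _ (isOpen_generateFrom_of_mem hTS) ?_
            rw [Set.mem_ofPred_eq]
            rw [← ENNReal.coe_lt_coe] at hqT
            simpa using hqT
          refine le_liminf_of_le (by isBoundedDefault) ?_
          filter_upwards [hmem] with ν' hν'
          exact hrq.le.trans (hν'.le.trans (measure_mono hTG))
      have : SecondCountableTopology (ProbabilityMeasure X) := ⟨S, hcount, htop⟩
      rw [borel_eq_generateFrom_of_subbasis htop]
      refine MeasurableSpace.generateFrom_le ?_
      rintro _ ⟨⟨T, q⟩, ⟨hT, -⟩, rfl⟩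
      exact measurableSet_lt measurable_const
        ((Measure.measurable_coe (hopen T hT).measurableSet).comp measurable_subtype_coe)

end BorelProbabilityMeasure

/-! ### Randomized policies over an uncontrolled Markov chain, and their derandomization. -/

section RandomizedPolicy

open ENNReal

variable {Z : Type*} [MeasurableSpace Z] {M : ℕ → ℕ}

/-- Appends the output `q_t` to the history `q_{[0,t-1]}`. -/
def appendOut (M : ℕ → ℕ) (t : ℕ) (q : OutHist M t) (j : Fin (M t)) : OutHist M (t + 1) :=
  Fin.snoc (α := fun s : Fin (t + 1) => Fin (M s)) q j

lemma measurable_appendOut (t : ℕ) :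
    Measurable fun p : OutHist M t × Fin (M t) => appendOut M t p.1 p.2 :=
  measurable_of_countable _

/-- A randomized policy: `q_t` is drawn from a distribution depending on `(z_t, q_{[0,t-1]})`. -/
abbrev RandomizedPolicy (Z : Type*) [MeasurableSpace Z] (M : ℕ → ℕ) : Type _ :=
  (t : ℕ) → Kernel (Z × OutHist M t) (Fin (M t))

/-- The transition from `((z_t, q_{[0,t-1]}), q_t)` to `(z_{t+1}, q_{[0,t]})` when `z` is a Markov
chain with transition kernel `Φ`. -/
def stepKernel (Φ : Kernel Z Z) (M : ℕ → ℕ) (t : ℕ) :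
    Kernel ((Z × OutHist M t) × Fin (M t)) (Z × OutHist M (t + 1)) :=
  (Φ.comap (fun a => a.1.1) (by fun_prop)) ×ₖ
    Kernel.deterministic (fun a => appendOut M t a.1.2 a.2)
      ((measurable_appendOut t).comp (measurable_fst.snd.prodMk measurable_snd))

instance (Φ : Kernel Z Z) [IsMarkovKernel Φ] (t : ℕ) : IsMarkovKernel (stepKernel Φ M t) := by
  unfold stepKernel; infer_instance

lemma lintegral_stepKernel (Φ : Kernel Z Z) [IsMarkovKernel Φ] (t : ℕ)
    (a : (Z × OutHist M t) × Fin (M t)) {f : Z × OutHist M (t + 1) → ℝ≥0∞} (hf : Measurable f) :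
    ∫⁻ b, f b ∂stepKernel Φ M t a = ∫⁻ z, f (z, appendOut M t a.1.2 a.2) ∂Φ a.1.1 := by
  rw [stepKernel, Kernel.lintegral_prod_deterministic _ _ _ hf, Kernel.lintegral_comap]

/-- The law of `(z_t, q_{[0,t-1]})` under a randomized policy. -/
def histLaw (ρ : Measure Z) (Φ : Kernel Z Z) (κ : RandomizedPolicy Z M) :
    (t : ℕ) → Measure (Z × OutHist M t)
  | 0 => ρ.map fun z => (z, fun s => s.elim0)
  | t + 1 => stepKernel Φ M t ∘ₘ (histLaw ρ Φ κ t ⊗ₘ κ t)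

/-- The law of `((z_t, q_{[0,t-1]}), q_t)` under a randomized policy. -/
def outLaw (ρ : Measure Z) (Φ : Kernel Z Z) (κ : RandomizedPolicy Z M) (t : ℕ) :
    Measure ((Z × OutHist M t) × Fin (M t)) :=
  histLaw ρ Φ κ t ⊗ₘ κ t

variable {ρ : Measure Z} {Φ : Kernel Z Z}

lemma histLaw_congr {κ κ' : RandomizedPolicy Z M} {t : ℕ} (h : ∀ s < t, κ s = κ' s) :
    histLaw ρ Φ κ t = histLaw ρ Φ κ' t := by
  induction t with
  | zero => rfl
  | succ t ih =>
    rw [histLaw, histLaw, ih fun s hs => h s (hs.trans t.lt_succ_self), h t t.lt_succ_self]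

lemma outLaw_congr {κ κ' : RandomizedPolicy Z M} {t : ℕ} (h : ∀ s ≤ t, κ s = κ' s) :
    outLaw ρ Φ κ t = outLaw ρ Φ κ' t := by
  rw [outLaw, outLaw, histLaw_congr fun s hs => h s hs.le, h t le_rfl]

variable [IsProbabilityMeasure ρ] [IsMarkovKernel Φ]

instance isProbabilityMeasure_histLaw (κ : RandomizedPolicy Z M) [∀ t, IsMarkovKernel (κ t)]
    (t : ℕ) : IsProbabilityMeasure (histLaw ρ Φ κ t) := by
  induction t with
  | zero => exact Measure.isProbabilityMeasure_map (by fun_prop)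
  | succ t ih => rw [histLaw]; infer_instance

instance isProbabilityMeasure_outLaw (κ : RandomizedPolicy Z M) [∀ t, IsMarkovKernel (κ t)]
    (t : ℕ) : IsProbabilityMeasure (outLaw ρ Φ κ t) := by
  rw [outLaw]; infer_instance

instance isMarkovKernel_update (κ : RandomizedPolicy Z M) [∀ t, IsMarkovKernel (κ t)] (t : ℕ)
    (η : Kernel (Z × OutHist M t) (Fin (M t))) [IsMarkovKernel η] (s : ℕ) :
    IsMarkovKernel (Function.update κ t η s) := by
  rcases eq_or_ne s t with rfl | h
  · rw [Function.update_self]; infer_instance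
  · rw [Function.update_of_ne h]; infer_instance

/-- The law of the outputs is an affine function of the randomization used at a single time. -/
lemma exists_lintegral_outLaw_update (κ : RandomizedPolicy Z M) [∀ t, IsMarkovKernel (κ t)]
    (t s : ℕ) (f : (Z × OutHist M s) × Fin (M s) → ℝ≥0∞) (hf : Measurable f) :
    ∃ g : (Z × OutHist M t) × Fin (M t) → ℝ≥0∞, Measurable g ∧
      ∀ η : Kernel (Z × OutHist M t) (Fin (M t)), IsMarkovKernel η →
        ∫⁻ a, f a ∂outLaw ρ Φ (Function.update κ t η) s = ∫⁻ a, g a ∂(histLaw ρ Φ κ t ⊗ₘ η) := by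
  have hlt : ∀ s < t, ∀ η, Function.update κ t η s = κ s := fun s hs η =>
    Function.update_of_ne hs.ne _ _
  rcases lt_or_ge s t with hst | hst
  -- Before time `t` the law does not involve `η`, so a constant `g` works, every law having mass
  -- one.
  · refine ⟨fun _ => ∫⁻ a, f a ∂outLaw ρ Φ κ s, measurable_const, fun η hη => ?_⟩
    rw [lintegral_const, measure_univ, mul_one,
      outLaw_congr fun u hu => hlt u (hu.trans_lt hst) η]
  · induction s, hst using Nat.le_induction with
    | base =>
      refine ⟨f, hf, fun η hη => ?_⟩
      rw [outLaw, Function.update_self, histLaw_congr fun u hu => hlt u hu η]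
    | succ s hts ih =>
      -- Past `t`, the last output and the last transition do not involve `η`: integrating them out
      -- of `f` reduces to time `s`.
      have hf₁ : Measurable fun b : Z × OutHist M (s + 1) => ∫⁻ j, f (b, j) ∂κ (s + 1) b :=
        hf.lintegral_kernel_prod_right'
      have hf₂ : Measurable fun a : (Z × OutHist M s) × Fin (M s) =>
          ∫⁻ b, ∫⁻ j, f (b, j) ∂κ (s + 1) b ∂stepKernel Φ M s a :=
        hf₁.lintegral_kernel
      obtain ⟨g, hg, h⟩ := ih _ hf₂
      refine ⟨g, hg, fun η hη => ?_⟩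
      rw [← h η hη, outLaw, Function.update_of_ne (by omega), Measure.lintegral_compProd hf,
        histLaw, Measure.lintegral_bind (Kernel.aemeasurable _) hf₁.aemeasurable, outLaw]

variable [∀ t, Nonempty (Fin (M t))]

/-- The randomization at a single time can be removed without increasing the infimum of a sequence
of costs. -/
lemma exists_deterministic_update (κ : RandomizedPolicy Z M) [∀ t, IsMarkovKernel (κ t)] (T t : ℕ)
    (c : ℕ → ∀ s, (Z × OutHist M s) × Fin (M s) → ℝ≥0∞) (hc : ∀ n s, Measurable (c n s)) :
    ∃ (F : Z × OutHist M t → Fin (M t)) (hF : Measurable F),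
      ⨅ n, ∑ s ∈ Finset.range T,
        ∫⁻ a, c n s a ∂outLaw ρ Φ (Function.update κ t (Kernel.deterministic F hF)) s ≤
      ⨅ n, ∑ s ∈ Finset.range T, ∫⁻ a, c n s a ∂outLaw ρ Φ κ s := by
  choose g hg hgη using fun n s =>
    exists_lintegral_outLaw_update (ρ := ρ) (Φ := Φ) κ t s (c n s) (hc n s)
  set G : ℕ → (Z × OutHist M t) × Fin (M t) → ℝ≥0∞ := fun n a => ∑ s ∈ Finset.range T, g n s a
    with hG
  have hGm : ∀ n, Measurable (G n) := fun n => Finset.measurable_fun_sum _ fun s _ => hg n s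
  have hGa : ∀ n a, Measurable fun j => G n (a, j) := fun n a =>
    (hGm n).comp measurable_prodMk_left
  have hsum : ∀ η : Kernel (Z × OutHist M t) (Fin (M t)), IsMarkovKernel η → ∀ n,
      ∑ s ∈ Finset.range T, ∫⁻ a, c n s a ∂outLaw ρ Φ (Function.update κ t η) s =
        ∫⁻ a, G n a ∂(histLaw ρ Φ κ t ⊗ₘ η) := by
    intro η hη n
    rw [hG, lintegral_finsetSum _ fun s _ => hg n s]
    exact Finset.sum_congr rfl fun s _ => hgη n s η hη
  -- The kernel is realized as `F a ξ` with `ξ` uniform on the unit interval, so each fixed seed `ξ`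
  -- gives a deterministic map.
  obtain ⟨F, hF, hFκ⟩ := (κ t).exists_measurable_map_eq_unitInterval
  have hFξ : ∀ ξ, Measurable fun a => F a ξ := fun ξ =>
    hF.comp (measurable_id.prodMk measurable_const)
  have hdet : ∀ ξ n, ∫⁻ a, G n a ∂(histLaw ρ Φ κ t ⊗ₘ Kernel.deterministic _ (hFξ ξ)) =
      ∫⁻ a, G n (a, F a ξ) ∂histLaw ρ Φ κ t := by
    intro ξ n
    rw [Measure.lintegral_compProd (hGm n)]
    refine lintegral_congr fun a => ?_
    rw [Kernel.lintegral_deterministic' _ (hGa n a)]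
  have hmeas : ∀ n, Measurable fun p : (Z × OutHist M t) × unitInterval =>
      G n (p.1, F p.1 p.2) := fun n => (hGm n).comp (measurable_fst.prodMk hF)
  have hmean : ∀ n, ∫⁻ ξ, ∫⁻ a, G n (a, F a ξ) ∂histLaw ρ Φ κ t =
      ∫⁻ a, G n a ∂(histLaw ρ Φ κ t ⊗ₘ κ t) := by
    intro n
    rw [← lintegral_lintegral_swap (hmeas n).aemeasurable, Measure.lintegral_compProd (hGm n)]
    refine lintegral_congr fun a => ?_
    rw [← hFκ a, lintegral_map (hGa n a) hF.of_uncurry_left]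
  have hinf : Measurable fun ξ => ⨅ n, ∫⁻ a, G n (a, F a ξ) ∂histLaw ρ Φ κ t :=
    Measurable.iInf fun n => (hmeas n).lintegral_prod_left'
  -- The infimum is taken before averaging, so that one seed serves the whole sequence of costs;
  -- measurability of this infimum uses that the sequence is countable.
  obtain ⟨ξ, hξ⟩ := exists_le_lintegral (μ := (volume : Measure unitInterval)) hinf.aemeasurable
  refine ⟨_, hFξ ξ, ?_⟩
  calc _ = ⨅ n, ∫⁻ a, G n (a, F a ξ) ∂histLaw ρ Φ κ t :=
        iInf_congr fun n => by rw [hsum _ inferInstance, hdet]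
    _ ≤ _ := hξ
    _ ≤ ⨅ n, ∫⁻ ξ, ∫⁻ a, G n (a, F a ξ) ∂histLaw ρ Φ κ t := le_iInf_lintegral _
    _ = _ := iInf_congr fun n => by
        rw [hmean, ← hsum _ inferInstance, Function.update_eq_self]

/-- A randomized policy can be replaced by a deterministic one without increasing the infimum of a
sequence of costs. -/
lemma exists_deterministic_policy (κ : RandomizedPolicy Z M) [∀ t, IsMarkovKernel (κ t)] (T : ℕ)
    (c : ℕ → ∀ s, (Z × OutHist M s) × Fin (M s) → ℝ≥0∞) (hc : ∀ n s, Measurable (c n s)) :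
    ∃ (F : ∀ t, Z × OutHist M t → Fin (M t)) (hF : ∀ t, Measurable (F t)),
      ⨅ n, ∑ s ∈ Finset.range T,
        ∫⁻ a, c n s a ∂outLaw ρ Φ (fun t => Kernel.deterministic (F t) (hF t)) s ≤
      ⨅ n, ∑ s ∈ Finset.range T, ∫⁻ a, c n s a ∂outLaw ρ Φ κ s := by
  have key : ∀ k : ℕ, ∃ κ' : RandomizedPolicy Z M, (∀ t, IsMarkovKernel (κ' t)) ∧
      (∀ t < k, ∃ (F : Z × OutHist M t → Fin (M t)) (hF : Measurable F),
        κ' t = Kernel.deterministic F hF) ∧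
      ⨅ n, ∑ s ∈ Finset.range T, ∫⁻ a, c n s a ∂outLaw ρ Φ κ' s ≤
        ⨅ n, ∑ s ∈ Finset.range T, ∫⁻ a, c n s a ∂outLaw ρ Φ κ s := by
    intro k
    induction k with
    | zero => exact ⟨κ, inferInstance, fun t ht => absurd ht t.not_lt_zero, le_rfl⟩
    | succ k ih =>
      obtain ⟨κ', hκ', hdet, hle⟩ := ih
      obtain ⟨F, hF, h⟩ := exists_deterministic_update (ρ := ρ) (Φ := Φ) κ' T k c hc
      refine ⟨Function.update κ' k (Kernel.deterministic F hF), inferInstance, fun t ht => ?_,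
        h.trans hle⟩
      rcases eq_or_ne t k with rfl | htk
      · exact ⟨F, hF, Function.update_self ..⟩
      · rw [Function.update_of_ne htk]
        exact hdet t (by omega)
  obtain ⟨κ', -, hdet, hle⟩ := key T
  -- Times from `T` on do not enter the cost, so any constant map serves there.
  have hex : ∀ t, ∃ F : Z × OutHist M t → Fin (M t), Measurable F ∧
      ∀ hF : Measurable F, t < T → κ' t = Kernel.deterministic F hF := by
    intro t
    by_cases ht : t < T
    · obtain ⟨F, hF, h⟩ := hdet t ht
      exact ⟨F, hF, fun _ _ => h⟩
    · exact ⟨fun _ => Classical.arbitrary _, measurable_const, fun _ h => absurd h ht⟩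
  choose F hF h using hex
  refine ⟨F, hF, le_trans (le_of_eq ?_) hle⟩
  refine iInf_congr fun n => Finset.sum_congr rfl fun s hs => ?_
  rw [outLaw_congr fun u hu => (h u (hF u) (hu.trans_lt (Finset.mem_range.1 hs))).symm]

end RandomizedPolicy

/-! ### Regrouping independent variables. -/

section Independence

variable {Ω α β γ δ : Type*} [MeasurableSpace Ω] {μ : Measure Ω} [IsProbabilityMeasure μ]
  [MeasurableSpace α] [MeasurableSpace β] [MeasurableSpace γ] [MeasurableSpace δ]

/-- The hypotheses make the law of `(U, (V, V'))` a triple product, which can be reassociated. -/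
lemma indepFun_prodMk_of_indepFun_prodMk {U : Ω → α} {V : Ω → β} {V' : Ω → γ}
    (hU : Measurable U) (hV : Measurable V) (hV' : Measurable V')
    (h : IndepFun U (fun ω => (V ω, V' ω)) μ) (h' : IndepFun V V' μ) :
    IndepFun (fun ω => (U ω, V ω)) V' μ := by
  have h₁ := h.map_prod_eq_prod_map_map hU.aemeasurable (hV.prodMk hV').aemeasurable
  rw [h'.map_prod_eq_prod_map_map hV.aemeasurable hV'.aemeasurable,
    ← Measure.prodAssoc_prod] at h₁
  have h₂ : IndepFun U V μ := h.comp measurable_id measurable_fst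
  rw [indepFun_iff_map_prod_eq_prod_map_map (hU.prodMk hV).aemeasurable hV'.aemeasurable,
    h₂.map_prod_eq_prod_map_map hU.aemeasurable hV.aemeasurable]
  have h₃ := congrArg (Measure.map MeasurableEquiv.prodAssoc.symm) h₁
  rw [Measure.map_map (MeasurableEquiv.measurable _) (hU.prodMk (hV.prodMk hV')),
    Measure.map_map (MeasurableEquiv.measurable _) (MeasurableEquiv.measurable _)] at h₃
  rwa [MeasurableEquiv.symm_comp_self, Measure.map_id] at h₃

lemma indepFun_prodMk_prodMk {U : Ω → α} {U' : Ω → β} {V : Ω → γ} {V' : Ω → δ}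
    (hU : Measurable U) (hU' : Measurable U') (hV : Measurable V) (hV' : Measurable V')
    (h : IndepFun (fun ω => (U ω, U' ω)) (fun ω => (V ω, V' ω)) μ) (h₁ : IndepFun U U' μ)
    (h₂ : IndepFun V V' μ) : IndepFun (fun ω => (U ω, V ω)) (fun ω => (U' ω, V' ω)) μ := by
  have h₃ : IndepFun (fun ω => ((U ω, U' ω), V ω)) V' μ :=
    indepFun_prodMk_of_indepFun_prodMk (hU.prodMk hU') hV hV' h h₂
  have h₄ : IndepFun V (fun ω => (U ω, U' ω)) μ := (h.comp measurable_id measurable_fst).symm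
  have h₅ : IndepFun (fun ω => (V ω, U ω)) U' μ :=
    indepFun_prodMk_of_indepFun_prodMk hV hU hU' h₄ h₁
  have h₆ : IndepFun V' (fun ω => (U' ω, (U ω, V ω))) μ :=
    (h₃.comp (φ := fun p : (α × β) × γ => (p.1.2, (p.1.1, p.2))) (ψ := id)
      (by fun_prop) measurable_id).symm
  have h₇ : IndepFun U' (fun ω => (U ω, V ω)) μ :=
    (h₅.comp (φ := Prod.swap) measurable_swap measurable_id).symm
  exact ((indepFun_prodMk_of_indepFun_prodMk hV' hU' (hU.prodMk hV) h₆ h₇).comp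
    (φ := Prod.swap) measurable_swap measurable_id).symm

lemma lintegral_of_indepFun {U : Ω → α} {V : Ω → β} (hU : Measurable U) (hV : Measurable V)
    (h : IndepFun U V μ) {f : α × β → ENNReal} (hf : Measurable f) :
    ∫⁻ ω, f (U ω, V ω) ∂μ = ∫⁻ ω, ∫⁻ v, f (U ω, v) ∂(μ.map V) ∂μ := by
  have := Measure.isProbabilityMeasure_map (μ := μ) hV.aemeasurable
  rw [← lintegral_map (f := f) (g := fun ω => (U ω, V ω)) hf (hU.prodMk hV),
    h.map_prod_eq_prod_map_map hU.aemeasurable hV.aemeasurable, lintegral_prod _ hf.aemeasurable,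
    lintegral_map hf.lintegral_prod_right' hU]

end Independence

/-! ### The Markov property of the source. -/

namespace PartiallyObservedSource

open ENNReal

section

variable {Ω X Y W R : Type*} {m : MeasurableSpace Ω} [MeasurableSpace Ω] {μ : Measure Ω}
  [MeasurableSpace X] [MeasurableSpace Y] [MeasurableSpace W] [MeasurableSpace R]
  (S : PartiallyObservedSource μ X Y W R)

/-- The σ-algebra `m` is left free: besides the ambient one, it will be the one generated by `x_0`,
`w_{[0,t-1]}`, `r_{[0,t]}`. -/
lemma measurable_state_of_le {t : ℕ} (h₀ : Measurable[m] S.x₀)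
    (hw : ∀ s < t, Measurable[m] (S.w s)) : ∀ s ≤ t, Measurable[m] (S.state s)
  | 0, _ => h₀
  | s + 1, hs => S.measurable_f.comp
      (Measurable.prodMk (measurable_state_of_le h₀ hw s (by omega)) (hw s (by omega)))

lemma measurable_obsHist_of_le {t : ℕ} (h₀ : Measurable[m] S.x₀)
    (hw : ∀ s < t, Measurable[m] (S.w s)) (hr : ∀ s ≤ t, Measurable[m] (S.r s)) :
    Measurable[m] (S.obsHist t) :=
  @measurable_pi_lambda _ _ _ m _ _ fun s => S.measurable_g.comp
    (Measurable.prodMk (S.measurable_state_of_le h₀ hw s (by omega)) (hr s (by omega)))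

lemma comap_history_le {t : ℕ} (h₀ : Measurable[m] S.x₀)
    (hw : ∀ s < t, Measurable[m] (S.w s)) (hr : ∀ s ≤ t, Measurable[m] (S.r s)) :
    MeasurableSpace.comap (fun ω => (S.obsHist t ω, S.state t ω)) inferInstance ≤ m :=
  measurable_iff_comap_le.1 (Measurable.prodMk (S.measurable_obsHist_of_le h₀ hw hr)
    (S.measurable_state_of_le h₀ hw t le_rfl))

end

variable {Ω X Y W R : Type*} [MeasurableSpace Ω] {μ : Measure Ω} [MeasurableSpace X]
  [MeasurableSpace Y] [MeasurableSpace W] [MeasurableSpace R]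
  (S : PartiallyObservedSource μ X Y W R)

lemma measurable_state (t : ℕ) : Measurable (S.state t) :=
  S.measurable_state_of_le S.measurable_x₀ (fun s _ => S.measurable_w s) t le_rfl

lemma measurable_obsHist (t : ℕ) : Measurable (S.obsHist t) :=
  S.measurable_obsHist_of_le S.measurable_x₀ (fun s _ => S.measurable_w s)
    fun s _ => S.measurable_r s

lemma measurable_obs (t : ℕ) : Measurable (S.obs t) :=
  S.measurable_g.comp ((S.measurable_state t).prodMk (S.measurable_r t))

/-- The map `(x_t, (w_t, r_{t+1})) ↦ (y_{t+1}, x_{t+1})`. -/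
def nextPair (p : X × (W × R)) : Y × X := (S.g (S.f p.1 p.2.1) p.2.2, S.f p.1 p.2.1)

lemma measurable_nextPair : Measurable S.nextPair := by
  have hf : Measurable fun p : X × (W × R) => S.f p.1 p.2.1 :=
    S.measurable_f.comp (measurable_fst.prodMk measurable_snd.fst)
  exact (S.measurable_g.comp (hf.prodMk measurable_snd.snd)).prodMk hf

variable [IsProbabilityMeasure μ]

/-- The history is a function of `x_0`, `w_{[0,t-1]}`, `r_{[0,t]}`, and this triple is independent
of the fresh noise `(w_t, r_{t+1})`. -/
lemma indepFun_history_noise (t : ℕ) :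
    IndepFun (fun ω => (S.obsHist t ω, S.state t ω)) (fun ω => (S.w t ω, S.r (t + 1) ω)) μ := by
  set w' : Ω → (Finset.range t → W) := fun ω s => S.w s ω
  set r' : Ω → (Finset.range (t + 1) → R) := fun ω s => S.r s ω
  have hw' : Measurable w' := measurable_pi_lambda _ fun s => S.measurable_w s
  have hr' : Measurable r' := measurable_pi_lambda _ fun s => S.measurable_r s
  have hw : IndepFun w' (S.w t) μ :=
    (S.iIndep_w.indepFun_finset (Finset.range t) {t} (by simp) S.measurable_w).comp
      (φ := id) (ψ := fun v : (({t} : Finset ℕ) → W) => v ⟨t, Finset.mem_singleton_self t⟩)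
      measurable_id (measurable_pi_apply _)
  have hr : IndepFun r' (S.r (t + 1)) μ :=
    (S.iIndep_r.indepFun_finset (Finset.range (t + 1)) {t + 1} (by simp) S.measurable_r).comp
      (φ := id)
      (ψ := fun v : (({t + 1} : Finset ℕ) → R) => v ⟨t + 1, Finset.mem_singleton_self _⟩)
      measurable_id (measurable_pi_apply _)
  have hwr : IndepFun (fun ω => (w' ω, S.w t ω)) (fun ω => (r' ω, S.r (t + 1) ω)) μ :=
    S.indep_w_r.comp (φ := fun v => ((fun s : Finset.range t => v s), v t))
      (ψ := fun v => ((fun s : Finset.range (t + 1) => v s), v (t + 1)))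
      (by fun_prop) (by fun_prop)
  have h₁ := indepFun_prodMk_prodMk hw' (S.measurable_w t) hr' (S.measurable_r _) hwr hw hr
  have h₂ : IndepFun S.x₀ (fun ω => ((w' ω, r' ω), (S.w t ω, S.r (t + 1) ω))) μ :=
    S.indep_x₀.comp (φ := id) (ψ := fun v : (ℕ → W) × (ℕ → R) => (((fun s : Finset.range t => v.1 s),
      (fun s : Finset.range (t + 1) => v.2 s)), (v.1 t, v.2 (t + 1))))
      measurable_id (by fun_prop)
  have h₃ := indepFun_prodMk_of_indepFun_prodMk S.measurable_x₀ (hw'.prodMk hr')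
    ((S.measurable_w t).prodMk (S.measurable_r (t + 1))) h₂ h₁
  rw [IndepFun_iff_Indep] at h₃ ⊢
  have hm := comap_measurable (m := inferInstance) fun ω => (S.x₀ ω, w' ω, r' ω)
  refine indep_of_indep_of_le_left h₃ (S.comap_history_le (measurable_fst.comp hm)
    (fun s hs => ?_) fun s hs => ?_)
  · exact ((measurable_pi_apply (⟨s, Finset.mem_range.2 hs⟩ : Finset.range t)).comp
      (measurable_fst.comp measurable_snd)).comp hm
  · exact ((measurable_pi_apply (⟨s, Finset.mem_range.2 (Nat.lt_succ_of_le hs)⟩ :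
      Finset.range (t + 1))).comp (measurable_snd.comp measurable_snd)).comp hm

/-- The joint law of the noise variables `(w_t, r_{t+1})`. -/
def noiseLaw : Measure (W × R) := (μ.map (S.w 0)).prod (μ.map (S.r 0))

instance : IsProbabilityMeasure S.noiseLaw := by
  have := Measure.isProbabilityMeasure_map (μ := μ) (S.measurable_w 0).aemeasurable
  have := Measure.isProbabilityMeasure_map (μ := μ) (S.measurable_r 0).aemeasurable
  unfold noiseLaw; infer_instance

lemma map_noise (t : ℕ) : μ.map (fun ω => (S.w t ω, S.r (t + 1) ω)) = S.noiseLaw := by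
  have h : IndepFun (S.w t) (S.r (t + 1)) μ :=
    S.indep_w_r.comp (measurable_pi_apply t) (measurable_pi_apply (t + 1))
  rw [h.map_prod_eq_prod_map_map (S.measurable_w t).aemeasurable
    (S.measurable_r (t + 1)).aemeasurable, (S.identDistrib_w t).map_eq,
    (S.identDistrib_r (t + 1)).map_eq, noiseLaw]

/-- The conditional law of `(y_{t+1}, x_{t+1})` given `x_t`. -/
def transition : Kernel X (Y × X) :=
  ((Kernel.id : Kernel X X) ×ₖ Kernel.const X S.noiseLaw).map S.nextPair

instance : IsMarkovKernel S.transition :=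
  Kernel.IsMarkovKernel.map _ S.measurable_nextPair

lemma lintegral_transition (x : X) {f : Y × X → ℝ≥0∞} (hf : Measurable f) :
    ∫⁻ p, f p ∂S.transition x = ∫⁻ v, f (S.nextPair (x, v)) ∂S.noiseLaw := by
  rw [transition, Kernel.lintegral_map _ S.measurable_nextPair _ hf,
    Kernel.lintegral_id_prod (f := fun a => f (S.nextPair a)) (hf.comp S.measurable_nextPair),
    Kernel.const_apply]

lemma lintegral_next_of_state (t : ℕ) {f : ((Fin (t + 1) → Y) × (Y × X)) → ℝ≥0∞}
    (hf : Measurable f) :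
    ∫⁻ ω, f (S.obsHist t ω, (S.obs (t + 1) ω, S.state (t + 1) ω)) ∂μ =
      ∫⁻ ω, ∫⁻ p, f (S.obsHist t ω, p) ∂S.transition (S.state t ω) ∂μ := by
  have h := lintegral_of_indepFun ((S.measurable_obsHist t).prodMk (S.measurable_state t))
    ((S.measurable_w t).prodMk (S.measurable_r (t + 1))) (S.indepFun_history_noise t)
    (f := fun q => f (q.1.1, S.nextPair (q.1.2, q.2)))
    (hf.comp (measurable_fst.fst.prodMk
      (S.measurable_nextPair.comp (measurable_fst.snd.prodMk measurable_snd))))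
  rw [S.map_noise t] at h
  refine h.trans (lintegral_congr fun ω => ?_)
  exact (S.lintegral_transition _ (f := fun p => f (S.obsHist t ω, p))
    (hf.comp measurable_prodMk_left)).symm

variable [StandardBorelSpace X] [Nonempty X]

lemma measurable_belief (t : ℕ) : Measurable (S.belief t) :=
  Measurable.subtype_mk (Kernel.measurable _)

lemma lintegral_state (t : ℕ) {f : ((Fin (t + 1) → Y) × X) → ℝ≥0∞} (hf : Measurable f) :
    ∫⁻ ω, f (S.obsHist t ω, S.state t ω) ∂μ =
      ∫⁻ ω, ∫⁻ x, f (S.obsHist t ω, x) ∂(S.belief t (S.obsHist t ω) : Measure X) ∂μ := by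
  rw [← lintegral_map (g := fun ω => (S.obsHist t ω, S.state t ω)) hf
    ((S.measurable_obsHist t).prodMk (S.measurable_state t)),
    ← compProd_map_condDistrib (S.measurable_state t).aemeasurable,
    Measure.lintegral_compProd hf,
    lintegral_map hf.lintegral_kernel_prod_right' (S.measurable_obsHist t)]
  rfl

end PartiallyObservedSource

/-- The identity kernel from probability measures on `X` to `X`. -/
def evalKernel (X : Type*) [MeasurableSpace X] : Kernel (ProbabilityMeasure X) X :=
  ⟨fun π => (π : Measure X), measurable_subtype_coe⟩

instance (X : Type*) [MeasurableSpace X] : IsMarkovKernel (evalKernel X) :=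
  ⟨fun π => inferInstanceAs (IsProbabilityMeasure (π : Measure X))⟩

/-! ### The nonlinear filter: the belief as a Markov chain. -/

namespace PartiallyObservedSource

open ENNReal

variable {Ω X Y W R : Type*} [MeasurableSpace Ω] {μ : Measure Ω} [MeasurableSpace X]
  [MeasurableSpace Y] [MeasurableSpace W] [MeasurableSpace R]
  [IsProbabilityMeasure μ] (S : PartiallyObservedSource μ X Y W R)

/-- The conditional law of `(y_{t+1}, x_{t+1})` given the belief `π_t`. -/
def predict : Kernel (ProbabilityMeasure X) (Y × X) := S.transition ∘ₖ evalKernel X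

instance : IsMarkovKernel S.predict := by unfold predict; infer_instance

variable [StandardBorelSpace X] [Nonempty X]

/-- Tower property: average the transition from `x_t` over the conditional law `π_t` of `x_t`. -/
lemma lintegral_next (t : ℕ) {f : ((Fin (t + 1) → Y) × (Y × X)) → ℝ≥0∞} (hf : Measurable f) :
    ∫⁻ ω, f (S.obsHist t ω, (S.obs (t + 1) ω, S.state (t + 1) ω)) ∂μ =
      ∫⁻ ω, ∫⁻ p, f (S.obsHist t ω, p) ∂S.predict (S.belief t (S.obsHist t ω)) ∂μ := by
  have hf' : Measurable fun q : (Fin (t + 1) → Y) × X => ∫⁻ p, f (q.1, p) ∂S.transition q.2 :=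
    Measurable.lintegral_kernel_prod_right'
      (κ := S.transition.comap (Prod.snd : (Fin (t + 1) → Y) × X → X) measurable_snd)
      (f := fun q : ((Fin (t + 1) → Y) × X) × (Y × X) => f (q.1.1, q.2)) (hf.comp (by fun_prop))
  rw [S.lintegral_next_of_state t hf, S.lintegral_state t hf']
  refine lintegral_congr fun ω => ?_
  exact (Kernel.lintegral_comp S.transition (evalKernel X) (S.belief t (S.obsHist t ω))
    (g := fun p => f (S.obsHist t ω, p))
    (hf.comp measurable_prodMk_left)).symm

variable [MeasurableSpace.CountablyGenerated Y]

/-- The Bayesian update of the belief `π_t` by the observation `y_{t+1}`. -/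
def update (p : ProbabilityMeasure X × Y) : ProbabilityMeasure X :=
  ⟨S.predict.condKernel p, inferInstance⟩

lemma measurable_update : Measurable S.update :=
  Measurable.subtype_mk (Kernel.measurable _)

lemma lintegral_predict (π : ProbabilityMeasure X) {f : Y × X → ℝ≥0∞} (hf : Measurable f) :
    ∫⁻ p, f p ∂S.predict π =
      ∫⁻ p, ∫⁻ x, f (p.1, x) ∂(S.update (π, p.1) : Measure X) ∂S.predict π := by
  have hf' : Measurable fun y => ∫⁻ x, f (y, x) ∂S.predict.condKernel (π, y) :=
    Measurable.lintegral_kernel_prod_right'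
      (κ := S.predict.condKernel.comap (fun y => (π, y)) measurable_prodMk_left) hf
  conv_lhs => rw [← S.predict.disintegrate S.predict.condKernel]
  rw [Kernel.lintegral_compProd _ _ _ hf, Kernel.lintegral_fst _ _ hf']
  rfl

/-- Conditional distributions are almost surely unique, so it suffices that the update kernel
disintegrates the joint law of `(y_{[0,t+1]}, x_{t+1})`. Given `y_{[0,t]}`, the pair `(y_{t+1},
x_{t+1})` has law `predict π_t`, whose disintegration along `y_{t+1}` defines the update. -/
lemma belief_succ_ae_eq (t : ℕ) :
    (fun ω => S.belief (t + 1) (S.obsHist (t + 1) ω)) =ᵐ[μ]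
      fun ω => S.update (S.belief t (S.obsHist t ω), S.obs (t + 1) ω) := by
  have hφ : Measurable fun y : Fin (t + 2) → Y =>
      (S.belief t (fun s => y s.castSucc), y (Fin.last _)) :=
    ((S.measurable_belief t).comp (by fun_prop)).prodMk (measurable_pi_apply _)
  set η : Kernel (Fin (t + 2) → Y) X := S.predict.condKernel.comap _ hφ with hη
  have hsnoc : Measurable fun p : (Fin (t + 1) → Y) × Y =>
      (Fin.snoc (α := fun _ => Y) p.1 p.2 : Fin (t + 2) → Y) := by
    refine measurable_pi_lambda _ fun s => ?_
    induction s using Fin.lastCases with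
    | last => simpa using measurable_snd
    | cast s => simpa using! (measurable_pi_apply s).comp (measurable_fst (α := Fin (t + 1) → Y) (β := Y))
  have hhist : ∀ ω, (Fin.snoc (α := fun _ => Y) (S.obsHist t ω) (S.obs (t + 1) ω) :
      Fin (t + 2) → Y) = S.obsHist (t + 1) ω := by
    intro ω
    funext s
    induction s using Fin.lastCases with
    | last => simp [obsHist]
    | cast s => simp [obsHist]
  have key : μ.map (fun ω => (S.obsHist (t + 1) ω, S.state (t + 1) ω)) =
      μ.map (S.obsHist (t + 1)) ⊗ₘ η := by
    refine Measure.ext_of_lintegral _ fun f hf => ?_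
    have hfη : Measurable fun y => ∫⁻ x, f (y, x) ∂η y := hf.lintegral_kernel_prod_right'
    rw [lintegral_map hf ((S.measurable_obsHist _).prodMk (S.measurable_state _)),
      Measure.lintegral_compProd hf, lintegral_map hfη (S.measurable_obsHist _)]
    simp_rw [← hhist]
    have h₁ := S.lintegral_next t
      (f := fun q => f (Fin.snoc (α := fun _ => Y) q.1 q.2.1, q.2.2))
      (hf.comp ((hsnoc.comp (measurable_fst.prodMk measurable_snd.fst)).prodMk
        measurable_snd.snd))
    have h₂ := S.lintegral_next t
      (f := fun q => ∫⁻ x, f (Fin.snoc (α := fun _ => Y) q.1 q.2.1, x)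
        ∂η (Fin.snoc (α := fun _ => Y) q.1 q.2.1))
      (hfη.comp (hsnoc.comp (measurable_fst.prodMk measurable_snd.fst)))
    refine h₁.trans (Eq.trans (lintegral_congr fun ω => ?_) h₂.symm)
    have h₃ := S.lintegral_predict (S.belief t (S.obsHist t ω))
      (f := fun p => f (Fin.snoc (α := fun _ => Y) (S.obsHist t ω) p.1, p.2))
      (hf.comp ((hsnoc.comp ((measurable_const (a := S.obsHist t ω)).prodMk
        measurable_fst)).prodMk measurable_snd))
    refine h₃.trans (lintegral_congr fun p => ?_)
    simp [hη, Kernel.comap_apply, update]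
  have hae := condDistrib_ae_eq_of_measure_eq_compProd (S.obsHist (t + 1))
    (S.measurable_state (t + 1)).aemeasurable key
  filter_upwards [ae_of_ae_map (S.measurable_obsHist (t + 1)).aemeasurable hae] with ω hω
  exact Subtype.ext hω

/-- The transition kernel of the belief process. -/
def beliefKernel : Kernel (ProbabilityMeasure X) (ProbabilityMeasure X) :=
  ((Kernel.id : Kernel (ProbabilityMeasure X) _) ×ₖ S.predict.fst).map S.update

instance : IsMarkovKernel S.beliefKernel :=
  Kernel.IsMarkovKernel.map _ S.measurable_update

lemma lintegral_beliefKernel (π : ProbabilityMeasure X) {f : ProbabilityMeasure X → ℝ≥0∞}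
    (hf : Measurable f) :
    ∫⁻ π', f π' ∂S.beliefKernel π = ∫⁻ p, f (S.update (π, p.1)) ∂S.predict π := by
  have hu : Measurable fun p => f (S.update p) := hf.comp S.measurable_update
  rw [beliefKernel, Kernel.lintegral_map _ S.measurable_update _ hf,
    Kernel.lintegral_id_prod hu,
    Kernel.lintegral_fst _ _ (g := fun y => f (S.update (π, y)))
      (hu.comp measurable_prodMk_left)]

/-- The belief process is Markov with respect to the observation history. -/
lemma lintegral_belief_succ (t : ℕ) {f : (Fin (t + 1) → Y) × ProbabilityMeasure X → ℝ≥0∞}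
    (hf : Measurable f) :
    ∫⁻ ω, f (S.obsHist t ω, S.belief (t + 1) (S.obsHist (t + 1) ω)) ∂μ =
      ∫⁻ ω, ∫⁻ π, f (S.obsHist t ω, π) ∂S.beliefKernel (S.belief t (S.obsHist t ω)) ∂μ := by
  have h₁ := S.lintegral_next t (f := fun q => f (q.1, S.update (S.belief t q.1, q.2.1)))
    (hf.comp (measurable_fst.prodMk (S.measurable_update.comp
      (((S.measurable_belief t).comp measurable_fst).prodMk measurable_snd.fst))))
  refine Eq.trans (lintegral_congr_ae ?_) (h₁.trans (lintegral_congr fun ω => ?_))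
  · filter_upwards [S.belief_succ_ae_eq t] with ω hω
    rw [hω]
  · exact (S.lintegral_beliefKernel _ (f := fun π => f (S.obsHist t ω, π))
      (hf.comp measurable_prodMk_left)).symm

end PartiallyObservedSource

open ENNReal

lemma Quantizer.measurable {A : Type*} [TopologicalSpace A] [MeasurableSpace A] [BorelSpace A]
    {m : ℕ} (Q : Quantizer A m) : Measurable Q.1 := by
  intro s hs
  rw [BorelSpace.measurable_eq (α := A)]
  exact Q.2 hs

/-- A Borel measurable map as a quantizer. -/
def Quantizer.ofMeasurable {A : Type*} [TopologicalSpace A] [MeasurableSpace A] [BorelSpace A]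
    {m : ℕ} (Q : A → Fin m) (hQ : Measurable Q) : Quantizer A m :=
  ⟨Q, by rwa [← BorelSpace.measurable_eq]⟩

/-! ### Outputs as functions of the observations. -/

namespace CompositePolicy

variable {Y : Type*} [TopologicalSpace Y] {M : ℕ → ℕ} (P : CompositePolicy Y M)

lemma outputs_succ (y : ℕ → Y) (t : ℕ) :
    outputs P y (t + 1) = appendOut M t (outputs P y t) (P t (outputs P y t, fun s => y s)) := rfl

lemma outputs_congr {y y' : ℕ → Y} {t : ℕ} (h : ∀ s < t, y s = y' s) :
    outputs P y t = outputs P y' t := by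
  induction t with
  | zero => rfl
  | succ t ih =>
    have hy : (fun s : Fin (t + 1) => y s) = fun s : Fin (t + 1) => y' s :=
      funext fun s => h s s.2
    rw [outputs_succ, outputs_succ, ih fun s hs => h s (hs.trans t.lt_succ_self), hy]

/-- The outputs `q_{[0,t]}` as a function of the observation history `y_{[0,t]}`. -/
def histOutputs (t : ℕ) (y : Fin (t + 1) → Y) : OutHist M (t + 1) :=
  -- The finite path is extended periodically; only times up to `t` are read.
  outputs P (fun s => y (Fin.ofNat (t + 1) s)) (t + 1)

lemma histOutputs_restrict (t : ℕ) (y : ℕ → Y) :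
    histOutputs P t (fun s => y s) = outputs P y (t + 1) :=
  outputs_congr P fun s hs => by simp [Nat.mod_eq_of_lt hs]

variable [SecondCountableTopology Y] [MeasurableSpace Y] [BorelSpace Y]

lemma measurable_outputs (t : ℕ) : Measurable fun y => outputs P y t := by
  induction t with
  | zero => exact measurable_const
  | succ t ih =>
    simp_rw [outputs_succ]
    exact (measurable_appendOut t).comp
      (ih.prodMk ((P t).measurable.comp (ih.prodMk (by fun_prop))))

lemma measurable_histOutputs (t : ℕ) : Measurable (histOutputs P t) :=
  (measurable_outputs P (t + 1)).comp (by fun_prop)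

end CompositePolicy

/-! ### The joint law of belief and outputs under a composite policy. -/

namespace PartiallyObservedSource

variable {Ω X Y W R U : Type*} [MeasurableSpace Ω] {μ : Measure Ω} [IsProbabilityMeasure μ]
  [MeasurableSpace X] [StandardBorelSpace X] [Nonempty X]
  [TopologicalSpace Y] [SecondCountableTopology Y] [MeasurableSpace Y] [BorelSpace Y]
  [MeasurableSpace W] [MeasurableSpace R] [MeasurableSpace U] {M : ℕ → ℕ}
  (S : PartiallyObservedSource μ X Y W R) (P : CompositePolicy Y M)

/-- The pair `(π_t, q_{[0,t-1]})` under a composite quantization policy. -/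
def info (t : ℕ) (ω : Ω) : ProbabilityMeasure X × OutHist M t :=
  (S.belief t (S.obsHist t ω), CompositePolicy.outputs P (fun s => S.obs s ω) t)

/-- The output `q_t` under a composite quantization policy. -/
def out (t : ℕ) (ω : Ω) : Fin (M t) :=
  P t (CompositePolicy.outputs P (fun s => S.obs s ω) t, S.obsHist t ω)

lemma measurable_info (t : ℕ) : Measurable (S.info P t) :=
  ((S.measurable_belief t).comp (S.measurable_obsHist t)).prodMk
    ((CompositePolicy.measurable_outputs P t).comp (measurable_pi_lambda _ S.measurable_obs))

omit [IsProbabilityMeasure μ] [StandardBorelSpace X] [Nonempty X] in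
lemma measurable_out (t : ℕ) : Measurable (S.out P t) :=
  (P t).measurable.comp
    (((CompositePolicy.measurable_outputs P t).comp
      (measurable_pi_lambda _ S.measurable_obs)).prodMk (S.measurable_obsHist t))

omit [SecondCountableTopology Y] [BorelSpace Y] in
lemma info_succ (t : ℕ) (ω : Ω) :
    S.info P (t + 1) ω =
      (S.belief (t + 1) (S.obsHist (t + 1) ω), appendOut M t (S.info P t ω).2 (S.out P t ω)) :=
  rfl

omit [SecondCountableTopology Y] [BorelSpace Y] in
lemma appendOut_info (t : ℕ) (ω : Ω) :
    appendOut M t (S.info P t ω).2 (S.out P t ω) =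
      CompositePolicy.histOutputs P t (S.obsHist t ω) :=
  (CompositePolicy.histOutputs_restrict P t fun s => S.obs s ω).symm

/-- Since `q_{[0,t]}` is a function of `y_{[0,t]}`, the Markov property relative to observations
lets `π_{t+1}` be drawn from `π_t` alone, whatever the policy. -/
lemma map_info_succ (t : ℕ) :
    μ.map (S.info P (t + 1)) =
      stepKernel S.beliefKernel M t ∘ₘ μ.map (fun ω => (S.info P t ω, S.out P t ω)) := by
  refine Measure.ext_of_lintegral _ fun f hf => ?_
  rw [lintegral_map hf (S.measurable_info P _),
    Measure.lintegral_bind (Kernel.aemeasurable _) hf.aemeasurable,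
    lintegral_map hf.lintegral_kernel ((S.measurable_info P t).prodMk (S.measurable_out P t))]
  have h := S.lintegral_belief_succ t
    (f := fun p => f (p.2, CompositePolicy.histOutputs P t p.1))
    (hf.comp (measurable_snd.prodMk
      ((CompositePolicy.measurable_histOutputs P t).comp measurable_fst)))
  refine Eq.trans (lintegral_congr fun ω => ?_) (h.trans (lintegral_congr fun ω => ?_))
  · rw [info_succ, appendOut_info]
  · rw [lintegral_stepKernel _ _ _ hf, appendOut_info]
    rfl

/-- Only the conditional law of `q_t` given `(π_t, q_{[0,t-1]})` matters: any further dependence of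
the policy on the observations is invisible in this law. -/
lemma map_info_eq_histLaw {κ : RandomizedPolicy (ProbabilityMeasure X) M}
    (hκ : ∀ t, μ.map (fun ω => (S.info P t ω, S.out P t ω)) = μ.map (S.info P t) ⊗ₘ κ t) (t : ℕ) :
    μ.map (S.info P t) =
      histLaw (μ.map fun ω => S.belief 0 (S.obsHist 0 ω)) S.beliefKernel κ t := by
  induction t with
  | zero =>
    exact (Measure.map_map (μ := μ)
      (g := fun z : ProbabilityMeasure X => (z, (fun s => s.elim0 : OutHist M 0)))
      (f := fun ω => S.belief 0 (S.obsHist 0 ω)) (by fun_prop)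
      ((S.measurable_belief 0).comp (S.measurable_obsHist 0))).symm
  | succ t ih => rw [map_info_succ, hκ, ih, histLaw]

lemma map_info_out_eq_outLaw {κ : RandomizedPolicy (ProbabilityMeasure X) M}
    (hκ : ∀ t, μ.map (fun ω => (S.info P t ω, S.out P t ω)) = μ.map (S.info P t) ⊗ₘ κ t) (t : ℕ) :
    μ.map (fun ω => (S.info P t ω, S.out P t ω)) =
      outLaw (μ.map fun ω => S.belief 0 (S.obsHist 0 ω)) S.beliefKernel κ t := by
  rw [hκ, S.map_info_eq_histLaw P hκ, outLaw]

/-- The cost at time `t`, shifted by `C`, as a function of `((π_t, q_{[0,t-1]}), q_t)`. -/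
def stageCost (c : X → U → ℝ) (C : ℝ) (γ : ReceiverPolicy U M) (t : ℕ)
    (a : (ProbabilityMeasure X × OutHist M t) × Fin (M t)) : ℝ≥0∞ :=
  ∫⁻ x, ENNReal.ofReal (c x ((γ t).1 (appendOut M t a.1.2 a.2)) + C) ∂(a.1.1 : Measure X)

omit [StandardBorelSpace X] [Nonempty X] in
lemma measurable_stageCost {c : X → U → ℝ} (hc : Measurable (Function.uncurry c)) (C : ℝ)
    (γ : ReceiverPolicy U M) (t : ℕ) : Measurable (stageCost c C γ t) := by
  have h : Measurable fun p : ((ProbabilityMeasure X × OutHist M t) × Fin (M t)) × X =>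
      ENNReal.ofReal (c p.2 ((γ t).1 (appendOut M t p.1.1.2 p.1.2)) + C) := by
    have hq : Measurable fun p : ((ProbabilityMeasure X × OutHist M t) × Fin (M t)) × X =>
        (p.1.1.2, p.1.2) := measurable_fst.fst.snd.prodMk measurable_fst.snd
    exact ENNReal.measurable_ofReal.comp (Measurable.add_const (hc.comp
      (measurable_snd.prodMk ((γ t).2.comp ((measurable_appendOut t).comp hq)))) C)
  exact Measurable.lintegral_kernel_prod_right' (κ := (evalKernel X).comap
    (fun a : (ProbabilityMeasure X × OutHist M t) × Fin (M t) => a.1.1) measurable_fst.fst) h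

/-- The action is determined by `y_{[0,t]}`, so conditioning on it replaces `x_t` by an average over
`π_t`. -/
lemma lintegral_stageCost {c : X → U → ℝ} (hc : Measurable (Function.uncurry c)) (C : ℝ)
    (γ : ReceiverPolicy U M) (t : ℕ) :
    ∫⁻ a, stageCost c C γ t a ∂μ.map (fun ω => (S.info P t ω, S.out P t ω)) =
      ∫⁻ ω, ENNReal.ofReal (c (S.state t ω)
        ((γ t).1 (CompositePolicy.outputs P (fun s => S.obs s ω) (t + 1))) + C) ∂μ := by
  rw [lintegral_map (measurable_stageCost hc C γ t)
    ((S.measurable_info P t).prodMk (S.measurable_out P t))]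
  have h := S.lintegral_state t (f := fun p =>
    ENNReal.ofReal (c p.2 ((γ t).1 (CompositePolicy.histOutputs P t p.1)) + C))
    (ENNReal.measurable_ofReal.comp (Measurable.add_const (hc.comp (measurable_snd.prodMk
      ((γ t).2.comp ((CompositePolicy.measurable_histOutputs P t).comp measurable_fst)))) C))
  refine Eq.trans (lintegral_congr fun ω => ?_)
    (h.symm.trans (lintegral_congr fun ω => ?_))
  · simp only [stageCost, appendOut_info]
    rfl
  · simp only [← appendOut_info]
    rfl

end PartiallyObservedSource

/-! ### Shifting the bounded cost by `C` per stage to work with nonnegative integrals. -/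

section Cost

variable {Ω X Y W R U : Type*} [MeasurableSpace Ω] {μ : Measure Ω} [IsProbabilityMeasure μ]
  [MeasurableSpace X] [TopologicalSpace Y] [SecondCountableTopology Y] [MeasurableSpace Y] [BorelSpace Y]
  [MeasurableSpace W] [MeasurableSpace R] [MeasurableSpace U] {M : ℕ → ℕ}
  (S : PartiallyObservedSource μ X Y W R)

omit [IsProbabilityMeasure μ] in
lemma measurable_stage {c : X → U → ℝ} (hc : Measurable (Function.uncurry c))
    (P : CompositePolicy Y M) (γ : ReceiverPolicy U M) (t : ℕ) :
    Measurable fun ω => c (S.state t ω)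
      ((γ t).1 (CompositePolicy.outputs P (fun s => S.obs s ω) (t + 1))) :=
  hc.comp ((S.measurable_state t).prodMk ((γ t).2.comp
    ((CompositePolicy.measurable_outputs P (t + 1)).comp
      (measurable_pi_lambda _ S.measurable_obs))))

lemma expectedCost_add {c : X → U → ℝ} (hc : Measurable (Function.uncurry c)) {C : ℝ}
    (hcb : ∀ x u, |c x u| ≤ C) (T : ℕ) (P : CompositePolicy Y M) (γ : ReceiverPolicy U M) :
    expectedCost S c T P γ + T * C = ∫ ω, ∑ t ∈ Finset.range T, (c (S.state t ω)
      ((γ t).1 (CompositePolicy.outputs P (fun s => S.obs s ω) (t + 1))) + C) ∂μ := by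
  have hint : Integrable (fun ω => ∑ t ∈ Finset.range T, c (S.state t ω)
      ((γ t).1 (CompositePolicy.outputs P (fun s => S.obs s ω) (t + 1)))) μ :=
    integrable_finsetSum _ fun t _ => Integrable.of_bound
      (measurable_stage S hc P γ t).aestronglyMeasurable C (ae_of_all _ fun ω => hcb _ _)
  simp_rw [Finset.sum_add_distrib]
  rw [integral_add hint (integrable_const _), expectedCost]
  simp

lemma expectedCost_add_nonneg {c : X → U → ℝ} (hc : Measurable (Function.uncurry c)) {C : ℝ}
    (hcb : ∀ x u, |c x u| ≤ C) (T : ℕ) (P : CompositePolicy Y M) (γ : ReceiverPolicy U M) :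
    0 ≤ expectedCost S c T P γ + T * C := by
  rw [expectedCost_add S hc hcb]
  exact integral_nonneg fun ω => Finset.sum_nonneg fun t _ => by
    linarith [neg_le_of_abs_le (hcb (S.state t ω)
      ((γ t).1 (CompositePolicy.outputs P (fun s => S.obs s ω) (t + 1))))]

variable [StandardBorelSpace X] [Nonempty X]

lemma ofReal_expectedCost_add {c : X → U → ℝ} (hc : Measurable (Function.uncurry c)) {C : ℝ}
    (hcb : ∀ x u, |c x u| ≤ C) (T : ℕ) (P : CompositePolicy Y M) (γ : ReceiverPolicy U M) :
    ENNReal.ofReal (expectedCost S c T P γ + T * C) = ∑ t ∈ Finset.range T,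
      ∫⁻ a, PartiallyObservedSource.stageCost c C γ t a
        ∂μ.map (fun ω => (S.info P t ω, S.out P t ω)) := by
  have hm := measurable_stage S hc P γ
  have hnn : ∀ t ω, 0 ≤ c (S.state t ω)
      ((γ t).1 (CompositePolicy.outputs P (fun s => S.obs s ω) (t + 1))) + C := fun t ω => by
    linarith [neg_le_of_abs_le (hcb (S.state t ω)
      ((γ t).1 (CompositePolicy.outputs P (fun s => S.obs s ω) (t + 1))))]
  rw [expectedCost_add S hc hcb, ofReal_integral_eq_lintegral_ofReal]
  · simp_rw [ENNReal.ofReal_sum_of_nonneg fun t _ => hnn t _]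
    rw [lintegral_finsetSum _ fun t _ => ((hm t).add_const C).ennreal_ofReal]
    exact Finset.sum_congr rfl fun t _ => (S.lintegral_stageCost P hc C γ t).symm
  · exact integrable_finsetSum _ fun t _ => (Integrable.of_bound (hm t).aestronglyMeasurable C
      (ae_of_all _ fun ω => hcb _ _)).add (integrable_const C)
  · exact ae_of_all _ fun ω => Finset.sum_nonneg fun t _ => hnn t ω

end Cost

/-! ### Replacing a composite policy by a belief-based one. -/

section Replacement

variable {Ω X Y W R U : Type*} [MeasurableSpace Ω] {μ : Measure Ω} [IsProbabilityMeasure μ]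
  [TopologicalSpace X] [PolishSpace X] [MeasurableSpace X] [BorelSpace X] [Nonempty X]
  [TopologicalSpace Y] [PolishSpace Y] [MeasurableSpace Y] [BorelSpace Y]
  [MeasurableSpace W] [MeasurableSpace R] [MeasurableSpace U] {M : ℕ → ℕ}
  (S : PartiallyObservedSource μ X Y W R)

omit [PolishSpace Y] [BorelSpace Y] in
lemma usesOnlyBelief_iff_selectsBeliefQuantizer (P : CompositePolicy Y M) :
    UsesOnlyBelief S P ↔ SelectsBeliefQuantizer S P := by
  refine forall_congr' fun t => ⟨fun ⟨F, hF⟩ => ?_, fun ⟨τ, hτ⟩ => ?_⟩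
  · exact ⟨fun q => Quantizer.ofMeasurable (fun π => F (π, q))
      (F.measurable.comp measurable_prodMk_right), hF⟩
  · exact ⟨Quantizer.ofMeasurable (fun p => τ p.2 p.1)
      (measurable_from_prod_countable_left fun q => (τ q).measurable), hτ⟩

/-- The composite quantization policy which uses only the belief and the past outputs through the
maps `F`. -/
def beliefPolicy (F : ∀ t, ProbabilityMeasure X × OutHist M t → Fin (M t))
    (hF : ∀ t, Measurable (F t)) : CompositePolicy Y M := fun t =>
  Quantizer.ofMeasurable (fun p => F t (S.belief t p.2, p.1))
    ((hF t).comp (((S.measurable_belief t).comp measurable_snd).prodMk measurable_fst))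

lemma usesOnlyBelief_beliefPolicy (F : ∀ t, ProbabilityMeasure X × OutHist M t → Fin (M t))
    (hF : ∀ t, Measurable (F t)) : UsesOnlyBelief S (beliefPolicy S F hF) := fun t =>
  ⟨Quantizer.ofMeasurable (F t) (hF t), fun _ _ => rfl⟩

/-- For every sequence of receiver policies there is a composite quantization policy which uses
only the belief and whose infimum of costs along the sequence is no larger. -/
lemma exists_usesOnlyBelief_iInf_le {c : X → U → ℝ} (hc : Measurable (Function.uncurry c)) {C : ℝ}
    (hcb : ∀ x u, |c x u| ≤ C) (T : ℕ) (P : CompositePolicy Y M) (γ : ℕ → ReceiverPolicy U M) :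
    ∃ P' : CompositePolicy Y M, UsesOnlyBelief S P' ∧
      ⨅ n, ENNReal.ofReal (expectedCost S c T P' (γ n) + T * C) ≤
        ⨅ n, ENNReal.ofReal (expectedCost S c T P (γ n) + T * C) := by
  have hΩ : Nonempty Ω := nonempty_of_isProbabilityMeasure μ
  -- The given policy produces an output at each time, so no output set is empty.
  have hM : ∀ t, Nonempty (Fin (M t)) := fun t => ⟨S.out P t (Classical.arbitrary Ω)⟩
  have : IsProbabilityMeasure (μ.map fun ω => S.belief 0 (S.obsHist 0 ω)) :=
    Measure.isProbabilityMeasure_map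
    ((S.measurable_belief 0).comp (S.measurable_obsHist 0)).aemeasurable
  have hκ : ∀ t, μ.map (fun ω => (S.info P t ω, S.out P t ω)) =
      μ.map (S.info P t) ⊗ₘ condDistrib (S.out P t) (S.info P t) μ := fun t =>
    (compProd_map_condDistrib (S.measurable_out P t).aemeasurable).symm
  obtain ⟨F, hF, h⟩ := exists_deterministic_policy
    (ρ := μ.map fun ω => S.belief 0 (S.obsHist 0 ω)) (Φ := S.beliefKernel)
    (fun t => condDistrib (S.out P t) (S.info P t) μ) T
    (fun n => PartiallyObservedSource.stageCost c C (γ n))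
    (fun n s => PartiallyObservedSource.measurable_stageCost hc C (γ n) s)
  refine ⟨beliefPolicy S F hF, usesOnlyBelief_beliefPolicy S F hF, ?_⟩
  -- Under the new policy `q_t` is a function of `(π_t, q_{[0,t-1]})`, so its conditional law is the
  -- deterministic kernel and the same law identification applies.
  have hκ' : ∀ t, μ.map (fun ω => (S.info (beliefPolicy S F hF) t ω,
      S.out (beliefPolicy S F hF) t ω)) = μ.map (S.info (beliefPolicy S F hF) t) ⊗ₘ
        Kernel.deterministic (F t) (hF t) := by
    intro t
    rw [Measure.compProd_deterministic, Measure.map_map (by fun_prop) (S.measurable_info _ t)]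
    rfl
  simp_rw [ofReal_expectedCost_add S hc hcb, S.map_info_out_eq_outLaw P hκ,
    S.map_info_out_eq_outLaw _ hκ']
  exact h

end Replacement

end CausalCoding
end

theorem theorem3 {Ω X Y W R U : Type*} [MeasurableSpace Ω] (μ : Measure Ω) [IsProbabilityMeasure μ]
    [TopologicalSpace X] [PolishSpace X] [MeasurableSpace X] [BorelSpace X] [Nonempty X]
    [TopologicalSpace Y] [PolishSpace Y] [MeasurableSpace Y] [BorelSpace Y]
    [MeasurableSpace W] [MeasurableSpace R] [MeasurableSpace U] [Nonempty U]
    (S : CausalCoding.PartiallyObservedSource μ X Y W R)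
    (c : X → U → ℝ) (hc : Measurable (Function.uncurry c)) (hcb : ∃ C, ∀ x u, |c x u| ≤ C)
    (M : ℕ → ℕ) (T : ℕ) (P : CausalCoding.CompositePolicy Y M) :
    (∀ P' : CausalCoding.CompositePolicy Y M,
      CausalCoding.UsesOnlyBelief S P' ↔ CausalCoding.SelectsBeliefQuantizer S P') ∧
    (∀ γ : CausalCoding.ReceiverPolicy U M, ∃ P' : CausalCoding.CompositePolicy Y M,
      CausalCoding.UsesOnlyBelief S P' ∧
      CausalCoding.expectedCost S c T P' γ ≤ CausalCoding.expectedCost S c T P γ) ∧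
    (∃ P' : CausalCoding.CompositePolicy Y M,
      CausalCoding.UsesOnlyBelief S P' ∧
      (⨅ γ : CausalCoding.ReceiverPolicy U M, CausalCoding.expectedCost S c T P' γ) ≤
        ⨅ γ : CausalCoding.ReceiverPolicy U M, CausalCoding.expectedCost S c T P γ) := by
  obtain ⟨C, hC⟩ := hcb
  have hnn := CausalCoding.expectedCost_add_nonneg S hc hC T (M := M)
  refine ⟨CausalCoding.usesOnlyBelief_iff_selectsBeliefQuantizer S, fun γ => ?_, ?_⟩
  · obtain ⟨P', hP', h⟩ :=
      CausalCoding.exists_usesOnlyBelief_iInf_le S hc hC T P (fun _ => γ)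
    refine ⟨P', hP', ?_⟩
    rw [iInf_const, iInf_const, ENNReal.ofReal_le_ofReal_iff (hnn P γ)] at h
    linarith
  · have hne : Nonempty (CausalCoding.ReceiverPolicy U M) :=
      ⟨fun _ => ⟨fun _ => Classical.arbitrary U, measurable_const⟩⟩
    have hbdd : ∀ P : CausalCoding.CompositePolicy Y M,
        BddBelow (Set.range fun γ : CausalCoding.ReceiverPolicy U M =>
          CausalCoding.expectedCost S c T P γ) := fun P =>
      ⟨-(T * C), by rintro _ ⟨γ, rfl⟩; linarith [hnn P γ]⟩
    -- A minimizing sequence for `P` replaces the possibly uncountable family of receivers by a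
    -- countable one.
    have hseq : ∀ n : ℕ, ∃ γ : CausalCoding.ReceiverPolicy U M,
        CausalCoding.expectedCost S c T P γ <
          (⨅ γ : CausalCoding.ReceiverPolicy U M, CausalCoding.expectedCost S c T P γ) +
            1 / ((n : ℝ) + 1) := fun n =>
      exists_lt_of_ciInf_lt (lt_add_of_pos_right _ Nat.one_div_pos_of_nat)
    choose γ hγ using hseq
    obtain ⟨P', hP', h⟩ := CausalCoding.exists_usesOnlyBelief_iInf_le S hc hC T P γ
    refine ⟨P', hP', le_of_forall_pos_lt_add fun ε hε => ?_⟩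
    obtain ⟨n, hn⟩ := exists_nat_one_div_lt hε
    have hlt : CausalCoding.expectedCost S c T P (γ n) + T * C <
        (⨅ γ : CausalCoding.ReceiverPolicy U M, CausalCoding.expectedCost S c T P γ) + ε + T * C := by
      linarith [hγ n]
    have h₁ : ⨅ n, ENNReal.ofReal (CausalCoding.expectedCost S c T P' (γ n) + T * C) <
        ENNReal.ofReal ((⨅ γ : CausalCoding.ReceiverPolicy U M,
          CausalCoding.expectedCost S c T P γ) + ε + T * C) :=
      (h.trans (iInf_le _ n)).trans_lt
        ((ENNReal.ofReal_lt_ofReal_iff_of_nonneg (hnn P (γ n))).2 hlt)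
    -- The receiver `γ k` that is good for `P'` need not be the near-optimal `γ n` for `P`.
    obtain ⟨k, hk⟩ := iInf_lt_iff.1 h₁
    rw [ENNReal.ofReal_lt_ofReal_iff_of_nonneg (hnn P' (γ k))] at hk
    exact (ciInf_le (hbdd P') (γ k)).trans_lt (by linarith)
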